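/- For $m \ge 1$ let $P_m$ denote the permutahedron graph: its vertices are the permutations of $\{1,\dots,m\}$, and $\sigma,\sigma'$ are adjacent if $\sigma'=\sigma\tau_i$ for some $1\le i\le m-1$, where $\tau_i=(i\;\,i+1)$. For $m\ge 0$ let $Q_m$ denote the graph of binary strings of length $m$, two strings being adjacent if they differ in exactly one position; a graph is called a hypercube if it is isomorphic to some $Q_m$. For a finite graph $G$ let $\mathcal{M}(G)$ denote the minimal size (number of edges) of a matching of $G$ that is maximal with respect to inclusion. There is an absolute constant $C$ such that the following holds. Let $n_1,\dots,n_k\ge 2$ be integers, let $n=n_1+\dots+n_k$, and let $P=P_{n_1}\,\square\,\cdots\,\square\,P_{n_k}$ be the Cartesian product of the graphs $P_{n_1},\dots,P_{n_k}$, with vertex set $V(P)$. Then \[ \frac{n-k}{3n-3k+1}\,|V(P)| \;\le\; \mathcal{M}(P) \;\le\; \begin{cases} \left(\frac13 + \frac{C}{\sqrt{n}}\right)|V(P)| & \text{if } P \text{ is a hypercube},\\[2pt] \frac13\,|V(P)| & \text{otherwise.} \end{cases} \] -/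

import Mathlib

/-- The sizes of the maximal matchings of `G`. A matching is a `G.Subgraph` in which every vertex
has exactly one neighbour, i.e. a set of pairwise disjoint edges together with the vertices it
covers. The subgraph order on matchings is inclusion of the edge sets, and the size is the number
of edges. -/
def SimpleGraph.maximalMatchingSizes {V : Type*} (G : SimpleGraph V) : Set ℕ :=
  {m | ∃ M : G.Subgraph, Maximal (fun M' : G.Subgraph => M'.IsMatching) M ∧ M.edgeSet.ncard = m}

/-- The minimal size of a maximal matching of the finite graph `G`. -/
noncomputable def SimpleGraph.minMaximalMatching {V : Type*} [Finite V] (G : SimpleGraph V) : ℕ :=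
  sInf G.maximalMatchingSizes

/-- The infimum defining `minMaximalMatching` is an attained minimum. -/
theorem SimpleGraph.isLeast_minMaximalMatching {V : Type*} [Finite V] (G : SimpleGraph V) :
    IsLeast G.maximalMatchingSizes G.minMaximalMatching := by
  have hbot : (⊥ : G.Subgraph).IsMatching := fun v hv => absurd hv (by simp)
  have hfin : {M : G.Subgraph | M.IsMatching}.Finite := Set.toFinite _
  obtain ⟨M, -, hM⟩ := hfin.exists_le_maximal hbot
  have hne : G.maximalMatchingSizes.Nonempty := ⟨_, M, hM, rfl⟩
  exact ⟨Nat.sInf_mem hne, fun m hm => Nat.sInf_le hm⟩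

/-- The permutahedron graph: the Cayley graph of the permutations of an `n`-element set
`{0, …, n - 1}` for the simple transpositions, where `σ` is adjacent to `σ * (i  i+1)`. -/
def permutahedron (n : ℕ) : SimpleGraph (Equiv.Perm (Fin n)) :=
  SimpleGraph.mulCayley {τ | ∃ i j : Fin n, (j : ℕ) = (i : ℕ) + 1 ∧ τ = Equiv.swap i j}

/-- The graph `Q_m` on the binary strings of length `m`, where two strings are adjacent if they
differ in exactly one position. -/
def hypercube (m : ℕ) : SimpleGraph (Fin m → Bool) where
  Adj x y := hammingDist x y = 1
  symm := ⟨fun x y h => by rwa [hammingDist_comm]⟩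
  loopless := ⟨fun x h => by simp at h⟩

/-- A graph is a hypercube if it is isomorphic to some `Q_m`. -/
def SimpleGraph.IsHypercube {V : Type*} (G : SimpleGraph V) : Prop :=
  ∃ m : ℕ, Nonempty (G ≃g hypercube m)

/-- The Cartesian product of a family of graphs: two tuples of vertices are adjacent if they are
adjacent in one coordinate and equal in all the other coordinates. -/
def SimpleGraph.cartesianProd {ι : Type*} {V : ι → Type*} (G : ∀ i, SimpleGraph (V i)) :
    SimpleGraph (∀ i, V i) where
  Adj x y := ∃ i, (G i).Adj (x i) (y i) ∧ ∀ j, j ≠ i → x j = y j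
  symm := ⟨by
    rintro x y ⟨i, h, h'⟩
    exact ⟨i, h.symm, fun j hj => (h' j hj).symm⟩⟩
  loopless := ⟨by
    rintro x ⟨i, h, -⟩
    exact (G i).loopless.irrefl _ h⟩

/-- The Cartesian product of the permutahedra of the numbers `n i`. -/
def permutahedronProd {k : ℕ} (n : Fin k → ℕ) : SimpleGraph (∀ i, Equiv.Perm (Fin (n i))) :=
  SimpleGraph.cartesianProd fun i => permutahedron (n i)

/-! ### Bounds for maximal matchings in general graphs -/

namespace SimpleGraph

variable {V : Type*} {G : SimpleGraph V}

/-! The product is a Cayley graph with `d = n - k` involutive generators, each commuting with all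
but at most two of them.

Lower bound (`card_mul_card_le_of_gen`): the set `U` of vertices missed by a maximal matching `M` is
independent, so `d |U|` edges join `U` to covered vertices. For a matching edge `{v, vt}` and a
generator `s ≠ t` commuting with `t`, the vertices `vs` and `vts` are adjacent, so at most one lies
in `U`. Hence the edge receives at most `(d - 1) + 2` edges from `U`, and `d (|V| - 2|M|) ≤ (d + 1)
|M|`.

Upper bound with some `n i ≥ 3`: a proper 3-colouring in which `x`, `xs`, `xt` always have different
colours lets the vertices of two colours be matched perfectly by `s`- and `t`-edges. The third class
is independent and has `|V| / 3` vertices. `hexColor` plus the ascents of the other factors is such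
a colouring.

Upper bound for the cube `Q_m`: leave out the levels congruent to `c` mod 3 and match the remaining
levels in consecutive pairs as fully as possible. The defects are differences of consecutive
binomial coefficients. Averaging over `c` gives `3 M ≤ 2 ^ m + m.choose (m / 2)`, and the central
coefficient is `O(2 ^ m / √m)`. -/

theorem Subgraph.IsMatching.ncard_verts [Finite V] {M : G.Subgraph} (hM : M.IsMatching) :
    M.verts.ncard = 2 * M.edgeSet.ncard := by
  classical
  have := Fintype.ofFinite V
  have hinj : Function.Injective M.hom := Subgraph.hom_injective
  have h := M.coe.sum_degrees_eq_twice_card_edges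
  have hd : ∀ (v : M.verts) [Fintype (M.coe.neighborSet v)], M.coe.degree v = 1 := by
    intro v _
    have := Fintype.ofFinite (M.neighborSet v)
    rw [Subgraph.coe_degree]
    convert (Subgraph.isMatching_iff_forall_degree.1 hM) v v.2
  have he : M.edgeSet = (Sym2.map M.hom) '' M.coe.edgeSet := by
    ext e
    induction e with | _ a b
    constructor
    · intro h
      have h : M.Adj a b := h
      exact ⟨s(⟨a, h.fst_mem⟩, ⟨b, h.snd_mem⟩), h, rfl⟩
    · rintro ⟨e, he, heq⟩
      induction e with | _ c d
      rw [← heq]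
      exact he
  rw [he, Set.ncard_image_of_injective _ (Sym2.map.injective hinj)]
  rw [← coe_edgeFinset, Set.ncard_coe_finset, ← h]
  simp only [hd, Finset.sum_const, smul_eq_mul, mul_one, Finset.card_univ]
  rw [Set.ncard_eq_toFinset_card', Set.toFinset_card]

/-- The matching whose edges join `x` to `f x`, for an involution `f` that moves vertices along
edges. -/
def matchingOfInvolution (f : V → V) (hf : Function.Involutive f)
    (hadj : ∀ x, f x ≠ x → G.Adj x (f x)) : G.Subgraph where
  verts := {x | f x ≠ x}
  Adj x y := f x ≠ x ∧ f x = y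
  adj_sub := by
    rintro x y ⟨h, rfl⟩
    exact hadj x h
  edge_vert h := h.1
  symm := ⟨by
    rintro x y ⟨h, rfl⟩
    exact ⟨by rw [hf x]; exact h.symm, hf x⟩⟩

theorem matchingOfInvolution_isMatching (f : V → V) (hf : Function.Involutive f)
    (hadj : ∀ x, f x ≠ x → G.Adj x (f x)) :
    (matchingOfInvolution f hf hadj).IsMatching :=
  fun x hx => ⟨f x, ⟨hx, rfl⟩, fun _ hy => hy.2.symm⟩

/-- A matching given by an involution `f` extends to a maximal matching, each of whose new edges
meets `W` as soon as the vertices fixed by `f` and outside `W` are independent. -/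
theorem two_mul_minMaximalMatching_le [Fintype V] [DecidableEq V] (f : V → V)
    (hf : Function.Involutive f) (hadj : ∀ x, f x ≠ x → G.Adj x (f x)) (W : Finset V)
    (hW : ∀ x y, f x = x → f y = y → G.Adj x y → x ∈ W ∨ y ∈ W) :
    2 * G.minMaximalMatching ≤ (Finset.univ.filter fun x => f x ≠ x).card + 2 * W.card := by
  classical
  have hfin : {M : G.Subgraph | M.IsMatching}.Finite := Set.toFinite _
  obtain ⟨M, hle, hM⟩ := hfin.exists_le_maximal (matchingOfInvolution_isMatching f hf hadj)
  have h1 : G.minMaximalMatching ≤ M.edgeSet.ncard :=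
    G.isLeast_minMaximalMatching.2 ⟨M, hM, rfl⟩
  have hMm : M.IsMatching := hM.prop
  have h2 := hMm.ncard_verts
  -- The `M`-partner of such an `x` is itself fixed by `f`, since a moved vertex is already matched
  -- to its image; so it lies in `W`. Partners are distinct, hence at most `W.card` such `x`.
  have key : ∀ x ∈ M.verts, f x = x → x ∉ W → ∃ y ∈ W, M.Adj x y := by
    intro x hx hfx hxW
    obtain ⟨y, hy, -⟩ := hMm hx
    refine ⟨y, ?_, hy⟩
    by_cases hfy : f y = y
    · exact (hW x y hfx hfy hy.adj_sub).resolve_left hxW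
    · have h3 : M.Adj y (f y) := hle.2 ⟨hfy, rfl⟩
      have h4 := hMm.eq_of_adj_left hy.symm h3
      rw [h4, hf y] at hfx
      exact absurd (h4 ▸ hfx.symm) hfy
  choose! g hg using key
  have h3 : M.verts ⊆ ↑((Finset.univ.filter fun x => f x ≠ x) ∪ W ∪
      (Finset.univ.filter fun x => x ∈ M.verts ∧ f x = x ∧ x ∉ W) : Finset V) := by
    intro x hx
    simp only [Finset.coe_union, Finset.coe_filter, Set.mem_union, Set.mem_ofPred_eq,
      Finset.mem_univ, true_and, Finset.mem_coe]
    tauto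
  have h4 : (Finset.univ.filter fun x => x ∈ M.verts ∧ f x = x ∧ x ∉ W).card ≤ W.card := by
    refine Finset.card_le_card_of_injOn g ?_ ?_
    · intro x hx
      simp only [Finset.coe_filter, Set.mem_ofPred_eq, Finset.mem_univ, true_and] at hx
      exact (hg x hx.1 hx.2.1 hx.2.2).1
    · intro x hx y hy hxy
      simp only [Finset.coe_filter, Set.mem_ofPred_eq, Finset.mem_univ, true_and] at hx hy
      refine hMm.eq_of_adj_right (hg x hx.1 hx.2.1 hx.2.2).2 ?_
      rw [hxy]
      exact (hg y hy.1 hy.2.1 hy.2.2).2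
  have h5 := Set.ncard_le_ncard h3 (Finset.finite_toSet _)
  rw [Set.ncard_coe_finset] at h5
  have h6 := Finset.card_union_le ((Finset.univ.filter fun x => f x ≠ x) ∪ W)
    (Finset.univ.filter fun x => x ∈ M.verts ∧ f x = x ∧ x ∉ W)
  have h7 := Finset.card_union_le (Finset.univ.filter fun x => f x ≠ x) W
  omega

/-- In a maximal matching no two adjacent vertices are both uncovered. -/
theorem Subgraph.mem_verts_or_of_maximal {M : G.Subgraph}
    (hM : Maximal (fun M' : G.Subgraph => M'.IsMatching) M) {x y : V} (h : G.Adj x y) :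
    x ∈ M.verts ∨ y ∈ M.verts := by
  by_contra! hxy
  have hs : (M ⊔ G.subgraphOfAdj h).IsMatching := by
    refine hM.prop.sup (Subgraph.IsMatching.subgraphOfAdj h) ?_
    rw [hM.prop.support_eq_verts, (Subgraph.IsMatching.subgraphOfAdj h).support_eq_verts]
    rw [Set.disjoint_right]
    rintro z (rfl | rfl)
    exacts [hxy.1, hxy.2]
  have h1 := (hM.2 hs le_sup_left).1
  exact hxy.1 (h1 (Or.inr (by simp)))

/-- A lower bound for maximal matchings in a graph on a group whose edges are the right
multiplications by the involutions `gen s`, each of which commutes with all but two others. -/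
theorem card_mul_card_le_of_gen [Group V] [Fintype V] [DecidableEq V] {I : Type*} [Fintype I]
    [DecidableEq I] (gen : I → V) (hadj : ∀ x y, G.Adj x y ↔ ∃ s, y = x * gen s)
    (hsq : ∀ s, gen s * gen s = 1)
    (hcomm : ∀ t, (Finset.univ.filter fun s => gen s * gen t ≠ gen t * gen s).card ≤ 2) :
    Fintype.card I * Fintype.card V ≤ (3 * Fintype.card I + 1) * G.minMaximalMatching := by
  classical
  obtain ⟨M, hM, hMc⟩ := G.isLeast_minMaximalMatching.1
  rw [← hMc]
  have hMm : M.IsMatching := hM.prop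
  have hcard := hMm.ncard_verts
  set U : Finset V := Finset.univ.filter fun x => x ∉ M.verts with hU
  set A : Finset V := Finset.univ.filter fun x => x ∈ M.verts with hA
  have hAc : A.card = 2 * M.edgeSet.ncard := by
    rw [← hcard, ← Set.ncard_coe_finset]
    congr 1
    ext x
    simp [hA]
  have hUA : A.card + U.card = Fintype.card V := by
    rw [hA, hU, Finset.card_filter_add_card_filter_not]
    rfl
  have hgadj : ∀ x s, G.Adj x (x * gen s) := fun x s => (hadj _ _).2 ⟨s, rfl⟩
  -- `T v s` indicates that the `s`-neighbour of `v` is uncovered; `p` below is the partner map of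
  -- `M`.
  let T : V → I → ℕ := fun v s => if v * gen s ∈ M.verts then 0 else 1
  choose! p hp using fun x (hx : x ∈ M.verts) => (hMm hx).exists
  have hpp : ∀ x ∈ M.verts, p (p x) = x := fun x hx =>
    hMm.eq_of_adj_left (hp _ (hp x hx).snd_mem) (hp x hx).symm
  -- edges from `U` to `A`, counted from `U`
  have hdouble : ∑ v ∈ A, ∑ s, T v s = Fintype.card I * U.card := by
    rw [Finset.sum_comm]
    have : ∀ s ∈ (Finset.univ : Finset I), ∑ v ∈ A, T v s = U.card := by
      intro s _
      rw [Finset.card_eq_sum_ones]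
      simp only [T, Finset.sum_ite, Finset.sum_const_zero, zero_add]
      refine Finset.sum_bij' (fun v _ => v * gen s) (fun v _ => v * gen s) ?_ ?_ ?_ ?_ ?_
      · intro v hv
        simp only [hA, Finset.mem_filter, Finset.mem_univ, true_and] at hv
        simpa [hU] using hv.2
      · intro v hv
        simp only [hU, Finset.mem_filter, Finset.mem_univ, true_and] at hv
        have := (Subgraph.mem_verts_or_of_maximal hM (hgadj v s)).resolve_left hv
        simp [hA, mul_assoc, hsq, this, hv]
      · intro v _
        simp [mul_assoc, hsq]
      · intro v _
        simp [mul_assoc, hsq]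
      · intros
        rfl
    rw [Finset.sum_congr rfl this]
    simp
  have hedge : ∀ v ∈ A, ∑ s, T v s + ∑ s, T (p v) s ≤ Fintype.card I + 1 := by
    intro v hv
    simp only [hA, Finset.mem_filter, Finset.mem_univ, true_and] at hv
    have hvp := hp v hv
    obtain ⟨t, ht⟩ := (hadj _ _).1 hvp.adj_sub
    -- The direction `s = t` leads back into the matching edge and contributes 0, a commuting `s` at
    -- most 1, a non-commuting `s` at most 2.
    have h1 : ∀ s, T v s + T (p v) s + (if s = t then 1 else 0) ≤
        1 + (if gen s * gen t ≠ gen t * gen s then 1 else 0) := by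
      intro s
      by_cases hst : s = t
      · subst hst
        have e1 : v * gen s ∈ M.verts := ht ▸ hvp.snd_mem
        have e2 : p v * gen s ∈ M.verts := by
          rw [ht, mul_assoc, hsq, mul_one]; exact hv
        simp [T, e1, e2]
      · by_cases hc : gen s * gen t = gen t * gen s
        · have h2 : G.Adj (v * gen s) (p v * gen s) := by
            rw [ht, mul_assoc v, ← hc, ← mul_assoc]
            exact hgadj _ _
          rcases Subgraph.mem_verts_or_of_maximal hM h2 with h3 | h3
          · simp only [T, h3, if_true, hst, hc, if_false]
            split_ifs <;> simp
          · simp only [T, h3, if_true, hst, hc, if_false]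
            split_ifs <;> simp
        · simp only [T, hst, if_false]
          split_ifs <;> simp_all
    have h2 := Finset.sum_le_sum fun s (_ : s ∈ (Finset.univ : Finset I)) => h1 s
    simp only [Finset.sum_add_distrib, Finset.sum_ite_eq', Finset.mem_univ, if_true,
      ← Finset.card_filter, Finset.sum_const, smul_eq_mul, mul_one] at h2
    have h3 := hcomm t
    have h4 : (Finset.univ : Finset I).card = Fintype.card I := rfl
    omega
  have hswap : ∑ v ∈ A, ∑ s, T (p v) s = ∑ v ∈ A, ∑ s, T v s := by
    have hmem : ∀ v ∈ A, p v ∈ A := by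
      intro v hv
      simp only [hA, Finset.mem_filter, Finset.mem_univ, true_and] at hv ⊢
      exact (hp v hv).snd_mem
    have hpA : ∀ v ∈ A, p (p v) = v := fun v hv => hpp v (by simpa [hA] using hv)
    exact Finset.sum_bij' (fun v _ => p v) (fun v _ => p v) hmem hmem hpA hpA (fun _ _ => rfl)
  -- Summing over covered vertices counts every matching edge from both ends, so both sides are
  -- doubled.
  have h := Finset.sum_le_sum hedge
  rw [Finset.sum_add_distrib, hswap, hdouble, Finset.sum_const, smul_eq_mul, hAc] at h
  rw [← hUA, hAc]
  nlinarith

/-- A graph with a proper colouring by three colours and two edge-preserving involutions such that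
each vertex and its two images have different colours has a small maximal matching: match the
vertices of two of the colours. -/
theorem three_mul_minMaximalMatching_le_of_coloring [Fintype V] [DecidableEq V] (c : V → ZMod 3)
    (hc : ∀ x y, G.Adj x y → c x ≠ c y) (s t : V → V) (hs : Function.Involutive s)
    (ht : Function.Involutive t) (hsadj : ∀ x, G.Adj x (s x)) (htadj : ∀ x, G.Adj x (t x))
    (hst : ∀ x, c (s x) ≠ c (t x)) :
    3 * G.minMaximalMatching ≤ Fintype.card V := by
  have three : ∀ a b d : ZMod 3, a ≠ b → a ≠ d → b ≠ d →
      (if a = 0 then 1 else 0) + (if b = 0 then 1 else 0) + (if d = 0 then 1 else 0) = 1 := by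
    decide
  have hcs : ∀ x, c x ≠ c (s x) := fun x => hc _ _ (hsadj x)
  have hct : ∀ x, c x ≠ c (t x) := fun x => hc _ _ (htadj x)
  -- A vertex of nonzero colour has exactly one of its two images in colour 0; `f` takes the other
  -- one.
  let f : V → V := fun x => if c x = 0 then x else if c (s x) = 0 then t x else s x
  have hone : ∀ x, c x ≠ 0 → (c (s x) = 0 ∧ c (t x) ≠ 0) ∨ (c (s x) ≠ 0 ∧ c (t x) = 0) := by
    intro x hx
    have := three _ _ _ (hcs x) (hct x) (hst x)
    by_cases h1 : c (s x) = 0 <;> by_cases h2 : c (t x) = 0 <;> simp_all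
  have hf : Function.Involutive f := by
    intro x
    by_cases hx : c x = 0
    · simp [f, hx]
    · rcases hone x hx with ⟨h1, h2⟩ | ⟨h1, h2⟩
      · have h3 : f x = t x := by simp [f, hx, h1]
        rw [h3]
        have h4 := hone (t x) h2
        rw [ht x] at h4
        have h5 : c (s (t x)) = 0 := by tauto
        simp [f, h2, h5, ht x]
      · have h3 : f x = s x := by simp [f, hx, h1]
        rw [h3]
        simp [f, h1, hs x, hx]
  have hfadj : ∀ x, f x ≠ x → G.Adj x (f x) := by
    intro x hx
    simp only [f] at hx ⊢
    split_ifs at hx ⊢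
    exacts [absurd rfl hx, htadj x, hsadj x]
  have hfix : ∀ x, f x = x ↔ c x = 0 := by
    intro x
    refine ⟨fun h => ?_, fun h => by simp [f, h]⟩
    by_contra h0
    simp only [f, h0, if_false] at h
    split_ifs at h
    · exact hct x (by rw [h])
    · exact hcs x (by rw [h])
  have h := two_mul_minMaximalMatching_le (G := G) f hf hfadj ∅ (by
    intro x y hx hy hxy
    exact absurd (((hfix x).1 hx).trans ((hfix y).1 hy).symm) (hc x y hxy))
  -- Exactly one of `x`, `s x`, `t x` has colour 0, and `s`, `t` are bijections, so the three
  -- indicator sums are equal.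
  have hcount : 3 * (Finset.univ.filter fun x => c x = 0).card = Fintype.card V := by
    have e1 : (Finset.univ.filter fun x => c x = 0).card = ∑ x, if c (s x) = 0 then 1 else 0 := by
      rw [Finset.card_filter]
      exact (Equiv.sum_comp hs.toPerm fun x => if c x = 0 then 1 else 0).symm
    have e2 : (Finset.univ.filter fun x => c x = 0).card = ∑ x, if c (t x) = 0 then 1 else 0 := by
      rw [Finset.card_filter]
      exact (Equiv.sum_comp ht.toPerm fun x => if c x = 0 then 1 else 0).symm
    have e3 : (Finset.univ.filter fun x => c x = 0).card + ∑ x, (if c (s x) = 0 then 1 else 0) +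
        ∑ x, (if c (t x) = 0 then 1 else 0) = Fintype.card V := by
      rw [Finset.card_filter, ← Finset.sum_add_distrib, ← Finset.sum_add_distrib]
      rw [Finset.sum_congr rfl fun x _ => three _ _ _ (hcs x) (hct x) (hst x)]
      simp
    omega
  have hsum := Finset.card_filter_add_card_filter_not (s := (Finset.univ : Finset V))
    (fun x => c x = 0)
  rw [Finset.card_univ] at hsum
  simp only [ne_eq, hfix, Finset.card_empty] at h
  omega

end SimpleGraph

/-! ### Products of permutahedra as Cayley graphs, and the lower bound -/

/-- The transposition of the `j`-th and the next element of `Fin n`. -/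
def adjSwap (n : ℕ) (j : Fin (n - 1)) : Equiv.Perm (Fin n) :=
  Equiv.swap ⟨j, by omega⟩ ⟨j + 1, by omega⟩

theorem adjSwap_mul_self {n : ℕ} (j : Fin (n - 1)) : adjSwap n j * adjSwap n j = 1 :=
  Equiv.swap_mul_self _ _

theorem adjSwap_ne_one {n : ℕ} (j : Fin (n - 1)) : adjSwap n j ≠ 1 := by
  rw [adjSwap, Ne, Equiv.swap_eq_one_iff]
  simp

theorem permutahedron_adj {n : ℕ} (σ ρ : Equiv.Perm (Fin n)) :
    (permutahedron n).Adj σ ρ ↔ ∃ j, ρ = σ * adjSwap n j := by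
  rw [permutahedron, SimpleGraph.mulCayley_adj']
  constructor
  · rintro ⟨-, τ, ⟨a, b, hab, rfl⟩, h⟩
    have hj : Equiv.swap a b = adjSwap n ⟨a, by omega⟩ := by
      rw [adjSwap]
      congr 1
      exact Fin.ext hab
    refine ⟨⟨a, by omega⟩, ?_⟩
    rw [← hj]
    rcases h with h | h
    · exact h.symm
    · rw [h, mul_assoc, Equiv.swap_mul_self, mul_one]
  · rintro ⟨j, rfl⟩
    exact ⟨fun h => adjSwap_ne_one j (by simpa using h), _, ⟨_, _, rfl, rfl⟩, Or.inl rfl⟩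

theorem adjSwap_commute {n : ℕ} {i j : Fin (n - 1)} (h : (i : ℕ) + 1 < j) :
    adjSwap n i * adjSwap n j = adjSwap n j * adjSwap n i := by
  refine (Equiv.Perm.Disjoint.commute ?_).eq
  intro x
  by_cases hx : x = ⟨j, by omega⟩ ∨ x = ⟨j + 1, by omega⟩
  · left
    apply Equiv.swap_apply_of_ne_of_ne <;> rcases hx with rfl | rfl <;> simp [Fin.ext_iff] <;> omega
  · right
    push Not at hx
    exact Equiv.swap_apply_of_ne_of_ne hx.1 hx.2

/-- The generator of the Cayley graph `permutahedronProd n` that acts by an adjacent transposition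
in one coordinate. -/
def prodGen {k : ℕ} (n : Fin k → ℕ) (s : Σ i, Fin (n i - 1)) : ∀ i, Equiv.Perm (Fin (n i)) :=
  Pi.mulSingle s.1 (adjSwap (n s.1) s.2)

section prodGen

variable {k : ℕ} {n : Fin k → ℕ}

theorem prodGen_mul_self (s : Σ i, Fin (n i - 1)) : prodGen n s * prodGen n s = 1 := by
  rw [prodGen, ← Pi.mulSingle_mul, adjSwap_mul_self, Pi.mulSingle_one]

theorem mul_prodGen_involutive (s : Σ i, Fin (n i - 1)) :
    Function.Involutive fun x : (∀ i, Equiv.Perm (Fin (n i))) => x * prodGen n s := by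
  intro x
  simp [mul_assoc, prodGen_mul_self]

theorem mul_prodGen_apply_self (x : ∀ i, Equiv.Perm (Fin (n i))) (i : Fin k) (j : Fin (n i - 1)) :
    (x * prodGen n ⟨i, j⟩) i = x i * adjSwap (n i) j := by
  simp [prodGen]

theorem mul_prodGen_apply_of_ne (x : ∀ i, Equiv.Perm (Fin (n i))) (s : Σ i, Fin (n i - 1))
    {i : Fin k} (h : i ≠ s.1) : (x * prodGen n s) i = x i := by
  simp [prodGen, h]

theorem permutahedronProd_adj (x y : ∀ i, Equiv.Perm (Fin (n i))) :
    (permutahedronProd n).Adj x y ↔ ∃ s, y = x * prodGen n s := by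
  constructor
  · rintro ⟨i, h, h'⟩
    obtain ⟨j, hj⟩ := (permutahedron_adj _ _).1 h
    refine ⟨⟨i, j⟩, funext fun l => ?_⟩
    by_cases hl : l = i
    · subst hl
      rw [mul_prodGen_apply_self, hj]
    · rw [mul_prodGen_apply_of_ne _ _ hl, h' l hl]
  · rintro ⟨⟨i, j⟩, rfl⟩
    refine ⟨i, (permutahedron_adj _ _).2 ⟨j, mul_prodGen_apply_self x i j⟩, fun l hl => ?_⟩
    rw [mul_prodGen_apply_of_ne _ _ hl]

theorem permutahedronProd_adj_mul_prodGen (x : ∀ i, Equiv.Perm (Fin (n i)))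
    (s : Σ i, Fin (n i - 1)) : (permutahedronProd n).Adj x (x * prodGen n s) :=
  (permutahedronProd_adj _ _).2 ⟨s, rfl⟩

/-- Generators in different coordinates commute, as do transpositions at distance at least two; only
the indices next to that of `t`, in the same coordinate, remain. -/
theorem card_not_commute_prodGen_le (t : Σ i, Fin (n i - 1)) :
    (Finset.univ.filter fun s => prodGen n s * prodGen n t ≠ prodGen n t * prodGen n s).card
      ≤ 2 := by
  have h : ∀ s, prodGen n s * prodGen n t ≠ prodGen n t * prodGen n s →
      s.1 = t.1 ∧ ((s.2 : ℕ) + 1 = t.2 ∨ (s.2 : ℕ) = t.2 + 1) := by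
    intro s hs
    obtain ⟨i, a⟩ := s
    obtain ⟨i', b⟩ := t
    have hi : i = i' := by
      by_contra hne
      exact hs (Pi.mulSingle_commute hne _ _).eq
    subst hi
    refine ⟨rfl, ?_⟩
    by_contra! hab
    apply hs
    simp only [prodGen, ← Pi.mulSingle_mul]
    congr 1
    simp only at hab
    rcases lt_trichotomy (a : ℕ) b with h | h | h
    · exact adjSwap_commute (by omega)
    · rw [Fin.ext h]
    · exact (adjSwap_commute (by omega)).symm
  -- For `t.2 = 0` the truncated difference merely adds the harmless index 0.
  calc _ ≤ ({(t.2 : ℕ) - 1, (t.2 : ℕ) + 1} : Finset ℕ).card := by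
        refine Finset.card_le_card_of_injOn (fun s => (s.2 : ℕ)) ?_ ?_
        · intro s hs
          have := h s (by simpa using hs)
          simp
          omega
        · intro s hs s' hs' heq
          have h1 := h s (by simpa using hs)
          have h2 := h s' (by simpa using hs')
          obtain ⟨i, a⟩ := s
          obtain ⟨i', b⟩ := s'
          have hi : i = i' := h1.1.trans h2.1.symm
          subst hi
          have : a = b := Fin.ext heq
          rw [this]
    _ ≤ 2 := Finset.card_le_two

theorem mul_card_le_minMaximalMatching_permutahedronProd :
    (∑ i, (n i - 1)) * Fintype.card (∀ i, Equiv.Perm (Fin (n i)))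
      ≤ (3 * ∑ i, (n i - 1) + 1) * (permutahedronProd n).minMaximalMatching := by
  have h := SimpleGraph.card_mul_card_le_of_gen (G := permutahedronProd n) (prodGen n)
    permutahedronProd_adj prodGen_mul_self card_not_commute_prodGen_le
  simpa using h

end prodGen

/-! ### The three-colouring when some factor has `n i ≥ 3` -/

theorem adjSwap_apply_left {n : ℕ} (j : Fin (n - 1)) :
    adjSwap n j ⟨j, by omega⟩ = ⟨j + 1, by omega⟩ :=
  Equiv.swap_apply_left _ _

theorem adjSwap_apply_right {n : ℕ} (j : Fin (n - 1)) :
    adjSwap n j ⟨j + 1, by omega⟩ = ⟨j, by omega⟩ :=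
  Equiv.swap_apply_right _ _

theorem adjSwap_apply_of_ne {n : ℕ} (j : Fin (n - 1)) {x : Fin n} (h : (x : ℕ) ≠ j)
    (h' : (x : ℕ) ≠ j + 1) : adjSwap n j x = x :=
  Equiv.swap_apply_of_ne_of_ne (fun e => h (by rw [e])) fun e => h' (by rw [e])

theorem adjSwap_lt_adjSwap {n : ℕ} (j : Fin (n - 1)) {a b : Fin n} (hab : a < b)
    (h : (a, b) ≠ (⟨j, by omega⟩, ⟨j + 1, by omega⟩)) : adjSwap n j a < adjSwap n j b := by
  rw [Ne, Prod.mk.injEq, Fin.ext_iff, Fin.ext_iff] at h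
  simp only at h
  rw [Fin.lt_def] at hab ⊢
  simp only [adjSwap, Equiv.swap_apply_def, Fin.ext_iff, apply_ite Fin.val]
  split_ifs <;> omega

/-- The number modulo 3 of the pairs of positions that a permutation does not invert. -/
def ascents {n : ℕ} (σ : Equiv.Perm (Fin n)) : ZMod 3 :=
  ∑ p ∈ Finset.univ.filter (fun p : Fin n × Fin n => p.1 < p.2), if σ p.1 < σ p.2 then 1 else 0

/-- The transposition permutes the ordered pairs of positions other than `(j, j + 1)`, so only the
status of that pair changes. -/
theorem ascents_mul_adjSwap {n : ℕ} (σ : Equiv.Perm (Fin n)) (j : Fin (n - 1)) :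
    ascents (σ * adjSwap n j) =
      ascents σ + if σ ⟨j, by omega⟩ < σ ⟨j + 1, by omega⟩ then -1 else 1 := by
  set q : Fin n × Fin n := (⟨j, by omega⟩, ⟨j + 1, by omega⟩) with hq
  set S := Finset.univ.filter (fun p : Fin n × Fin n => p.1 < p.2) with hS
  have hqS : q ∈ S := by simp [hS, hq]
  have hne : σ ⟨j, by omega⟩ ≠ σ ⟨j + 1, by omega⟩ := by
    simp [σ.injective.eq_iff]
  rw [ascents, ascents, ← Finset.add_sum_erase _ _ hqS, ← Finset.add_sum_erase _ _ hqS]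
  have hmem : ∀ p ∈ S.erase q, (adjSwap n j p.1, adjSwap n j p.2) ∈ S.erase q := by
    intro p hp
    rw [Finset.mem_erase, hS, Finset.mem_filter] at hp
    rw [Finset.mem_erase, hS, Finset.mem_filter]
    refine ⟨fun h => ?_, Finset.mem_univ _, adjSwap_lt_adjSwap j hp.2.2 hp.1⟩
    rw [hq, Prod.mk.injEq] at h
    have h1 : p.1 = ⟨j + 1, by omega⟩ := by
      rw [← adjSwap_apply_left, ← h.1, ← Equiv.Perm.mul_apply, adjSwap_mul_self]
      rfl
    have h2 : p.2 = ⟨j, by omega⟩ := by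
      rw [← adjSwap_apply_right, ← h.2, ← Equiv.Perm.mul_apply, adjSwap_mul_self]
      rfl
    have h3 := hp.2.2
    rw [h1, h2, Fin.lt_def] at h3
    simp at h3
  have hinv : ∀ p ∈ S.erase q, (adjSwap n j (adjSwap n j p.1), adjSwap n j (adjSwap n j p.2)) = p :=
    fun p _ => by simp only [← Equiv.Perm.mul_apply, adjSwap_mul_self, Equiv.Perm.one_apply]
  have hsum : ∑ p ∈ S.erase q, (if (σ * adjSwap n j) p.1 < (σ * adjSwap n j) p.2
      then (1 : ZMod 3) else 0) = ∑ p ∈ S.erase q, if σ p.1 < σ p.2 then 1 else 0 :=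
    Finset.sum_bij' (fun p _ => (adjSwap n j p.1, adjSwap n j p.2))
      (fun p _ => (adjSwap n j p.1, adjSwap n j p.2)) hmem hmem hinv hinv fun _ _ => rfl
  rw [hsum]
  simp only [hq, Equiv.Perm.mul_apply, adjSwap_apply_left, adjSwap_apply_right]
  rcases lt_or_gt_of_ne hne with h | h
  · simp only [h, h.not_gt, if_true, if_false]
    ring
  · simp only [h, h.not_gt, if_true, if_false]
    ring

/-- A proper colouring of the permutahedron that uses the colours `0, 1, 2, 0, 1, 2` around each
hexagon generated by the first two transpositions. -/
def hexColor {n : ℕ} (hn : 3 ≤ n) (σ : Equiv.Perm (Fin n)) : ZMod 3 :=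
  ascents σ + (if σ ⟨0, by omega⟩ < σ ⟨1, by omega⟩ then 1 else 0) -
    (if σ ⟨0, by omega⟩ < σ ⟨2, by omega⟩ then 1 else 0)

/-- Before reduction mod 3 the change is always ±1 or ±2. Only `j ≤ 2` can affect the correction
terms; there, transitivity of the order on the values of `σ` excludes the bad sign patterns. -/
theorem hexColor_mul_adjSwap_ne {n : ℕ} (hn : 3 ≤ n) (σ : Equiv.Perm (Fin n)) (j : Fin (n - 1)) :
    hexColor hn (σ * adjSwap n j) ≠ hexColor hn σ := by
  rw [hexColor, hexColor, ascents_mul_adjSwap]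
  obtain ⟨j, hj⟩ := j
  rw [← sub_ne_zero]
  have n01 : σ ⟨0, by omega⟩ ≠ σ ⟨1, by omega⟩ := by simp [σ.injective.eq_iff]
  have n02 : σ ⟨0, by omega⟩ ≠ σ ⟨2, by omega⟩ := by simp [σ.injective.eq_iff]
  have n12 : σ ⟨1, by omega⟩ ≠ σ ⟨2, by omega⟩ := by simp [σ.injective.eq_iff]
  match j, hj with
  | 0, hj =>
    have h0 : adjSwap n ⟨0, hj⟩ ⟨0, by omega⟩ = ⟨1, by omega⟩ := adjSwap_apply_left _
    have h1 : adjSwap n ⟨0, hj⟩ ⟨1, by omega⟩ = ⟨0, by omega⟩ := adjSwap_apply_right ⟨0, hj⟩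
    have h2 : adjSwap n ⟨0, hj⟩ ⟨2, by omega⟩ = ⟨2, by omega⟩ :=
      adjSwap_apply_of_ne _ (by simp) (by simp)
    simp only [Equiv.Perm.mul_apply, h0, h1, h2]
    simp only [zero_add]
    generalize ascents σ = A
    revert A
    split_ifs <;> first | decide | (exfalso; order)
  | 1, hj =>
    have h0 : adjSwap n ⟨1, hj⟩ ⟨0, by omega⟩ = ⟨0, by omega⟩ :=
      adjSwap_apply_of_ne _ (by simp) (by simp)
    have h1 : adjSwap n ⟨1, hj⟩ ⟨1, by omega⟩ = ⟨2, by omega⟩ := adjSwap_apply_left ⟨1, hj⟩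
    have h2 : adjSwap n ⟨1, hj⟩ ⟨2, by omega⟩ = ⟨1, by omega⟩ := adjSwap_apply_right ⟨1, hj⟩
    simp only [Equiv.Perm.mul_apply, h0, h1, h2]
    simp only [Nat.reduceAdd]
    generalize ascents σ = A
    revert A
    split_ifs <;> first | decide | (exfalso; order)
  | 2, hj =>
    have h0 : adjSwap n ⟨2, hj⟩ ⟨0, by omega⟩ = ⟨0, by omega⟩ :=
      adjSwap_apply_of_ne _ (by simp) (by simp)
    have h1 : adjSwap n ⟨2, hj⟩ ⟨1, by omega⟩ = ⟨1, by omega⟩ :=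
      adjSwap_apply_of_ne _ (by simp) (by simp)
    have h2 : adjSwap n ⟨2, hj⟩ ⟨2, by omega⟩ = ⟨3, by omega⟩ := adjSwap_apply_left ⟨2, hj⟩
    simp only [Equiv.Perm.mul_apply, h0, h1, h2]
    simp only [Nat.reduceAdd]
    generalize ascents σ = A
    revert A
    split_ifs <;> first | decide | (exfalso; order)
  | j + 3, hj =>
    have h0 : adjSwap n ⟨j + 3, hj⟩ ⟨0, by omega⟩ = ⟨0, by omega⟩ :=
      adjSwap_apply_of_ne _ (by simp) (by simp)
    have h1 : adjSwap n ⟨j + 3, hj⟩ ⟨1, by omega⟩ = ⟨1, by omega⟩ :=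
      adjSwap_apply_of_ne _ (by simp) (by simp)
    have h2 : adjSwap n ⟨j + 3, hj⟩ ⟨2, by omega⟩ = ⟨2, by omega⟩ :=
      adjSwap_apply_of_ne _ (by simp) (by simp)
    simp only [Equiv.Perm.mul_apply, h0, h1, h2]
    generalize ascents σ = A
    revert A
    split_ifs <;> decide

/-- With `a`, `b`, `d` the indicators of `σ 0 < σ 1`, `σ 0 < σ 2`, `σ 1 < σ 2`, the two colours
differ by `a - b + d + 1` mod 3, and transitivity forces `a - b + d` to be 0 or 1. -/
theorem hexColor_mul_adjSwap_zero_ne_one {n : ℕ} (hn : 3 ≤ n) (σ : Equiv.Perm (Fin n)) :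
    hexColor hn (σ * adjSwap n ⟨0, by omega⟩) ≠ hexColor hn (σ * adjSwap n ⟨1, by omega⟩) := by
  rw [hexColor, hexColor, ascents_mul_adjSwap, ascents_mul_adjSwap, ← sub_ne_zero]
  have n01 : σ ⟨0, by omega⟩ ≠ σ ⟨1, by omega⟩ := by simp [σ.injective.eq_iff]
  have n02 : σ ⟨0, by omega⟩ ≠ σ ⟨2, by omega⟩ := by simp [σ.injective.eq_iff]
  have n12 : σ ⟨1, by omega⟩ ≠ σ ⟨2, by omega⟩ := by simp [σ.injective.eq_iff]
  have h0 : adjSwap n ⟨0, by omega⟩ ⟨0, by omega⟩ = ⟨1, by omega⟩ := adjSwap_apply_left _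
  have h1 : adjSwap n ⟨0, by omega⟩ ⟨1, by omega⟩ = ⟨0, by omega⟩ :=
    adjSwap_apply_right ⟨0, by omega⟩
  have h2 : adjSwap n ⟨0, by omega⟩ ⟨2, by omega⟩ = ⟨2, by omega⟩ :=
    adjSwap_apply_of_ne _ (by simp) (by simp)
  have k0 : adjSwap n ⟨1, by omega⟩ ⟨0, by omega⟩ = ⟨0, by omega⟩ :=
    adjSwap_apply_of_ne _ (by simp) (by simp)
  have k1 : adjSwap n ⟨1, by omega⟩ ⟨1, by omega⟩ = ⟨2, by omega⟩ :=
    adjSwap_apply_left ⟨1, by omega⟩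
  have k2 : adjSwap n ⟨1, by omega⟩ ⟨2, by omega⟩ = ⟨1, by omega⟩ :=
    adjSwap_apply_right ⟨1, by omega⟩
  simp only [Equiv.Perm.mul_apply, h0, h1, h2, k0, k1, k2]
  simp only [zero_add, Nat.reduceAdd]
  generalize ascents σ = A
  revert A
  split_ifs <;> first | decide | (exfalso; order)

theorem three_mul_minMaximalMatching_permutahedronProd_le {k : ℕ} {n : Fin k → ℕ} (i : Fin k)
    (hi : 3 ≤ n i) :
    3 * (permutahedronProd n).minMaximalMatching
      ≤ Fintype.card (∀ i, Equiv.Perm (Fin (n i))) := by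
  -- A generator outside coordinate `i` changes the sum of ascents by ±1, so the colouring stays
  -- proper.
  let c : (∀ i, Equiv.Perm (Fin (n i))) → ZMod 3 := fun x =>
    hexColor hi (x i) + ∑ l ∈ Finset.univ.erase i, ascents (x l)
  have hci : ∀ x j, c (x * prodGen n ⟨i, j⟩) =
      hexColor hi (x i * adjSwap (n i) j) + ∑ l ∈ Finset.univ.erase i, ascents (x l) := by
    intro x j
    simp only [c]
    rw [mul_prodGen_apply_self]
    congr 1
    refine Finset.sum_congr rfl fun l hl => ?_
    rw [mul_prodGen_apply_of_ne _ _ (Finset.ne_of_mem_erase hl)]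
  refine SimpleGraph.three_mul_minMaximalMatching_le_of_coloring c ?_ _ _
    (mul_prodGen_involutive ⟨i, ⟨0, by omega⟩⟩) (mul_prodGen_involutive ⟨i, ⟨1, by omega⟩⟩)
    (fun x => permutahedronProd_adj_mul_prodGen x _)
    (fun x => permutahedronProd_adj_mul_prodGen x _) ?_
  · intro x y hxy
    obtain ⟨⟨l, j⟩, rfl⟩ := (permutahedronProd_adj _ _).1 hxy
    by_cases hl : l = i
    · subst hl
      rw [hci]
      simpa [c] using (hexColor_mul_adjSwap_ne hi (x l) j).symm
    · have hl' : l ∈ Finset.univ.erase i := by simp [hl]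
      simp only [c]
      rw [mul_prodGen_apply_of_ne _ _ (Ne.symm hl), ← Finset.add_sum_erase _ _ hl',
        ← Finset.add_sum_erase _ _ hl', mul_prodGen_apply_self, ascents_mul_adjSwap]
      rw [Finset.sum_congr (f := fun m => ascents ((x * prodGen n ⟨l, j⟩) m))
        (g := fun m => ascents (x m)) rfl fun m hm => by
          rw [mul_prodGen_apply_of_ne x ⟨l, j⟩ (Finset.ne_of_mem_erase hm)]]
      simp only [ne_eq, add_right_inj, add_left_inj, left_eq_add]
      split_ifs <;> decide
  · intro x
    rw [hci, hci]
    simpa using hexColor_mul_adjSwap_zero_ne_one hi (x i)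

/-! ### Binomial estimates -/

section Choose

theorem Nat.choose_succ_le_of_le_two_mul {m r : ℕ} (h : m ≤ 2 * r + 1) :
    m.choose (r + 1) ≤ m.choose r := by
  have h1 := Nat.choose_succ_right_eq m r
  have h2 : m - r ≤ r + 1 := by omega
  exact Nat.le_of_mul_le_mul_right (h1 ▸ Nat.mul_le_mul_left _ h2) (Nat.succ_pos r)

/-- The row is unimodal: it climbs from 1 to the central coefficient and falls to `m.choose (m + 1)
= 0`, so its total variation telescopes. In truncated subtraction, the sum of both differences is
the absolute difference. -/
theorem sum_dist_choose_le (m : ℕ) :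
    1 + ∑ r ∈ Finset.range (m + 1),
      ((m.choose r - m.choose (r + 1)) + (m.choose (r + 1) - m.choose r)) ≤
        2 * m.choose (m / 2) := by
  have h1 : ∀ j ≤ m / 2, 1 + ∑ r ∈ Finset.range j,
      ((m.choose r - m.choose (r + 1)) + (m.choose (r + 1) - m.choose r)) = m.choose j := by
    intro j
    induction j with
    | zero => simp
    | succ j ih =>
      intro hj
      have h2 := ih (by omega)
      have h3 := Nat.choose_le_succ_of_lt_half_left (r := j) (n := m) (by omega)
      rw [Finset.sum_range_succ]
      omega
  have h4 : ∀ j, m / 2 ≤ j → 1 + ∑ r ∈ Finset.range j,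
      ((m.choose r - m.choose (r + 1)) + (m.choose (r + 1) - m.choose r)) + m.choose j =
        2 * m.choose (m / 2) := by
    intro j hj
    induction j, hj using Nat.le_induction with
    | base => rw [h1 _ le_rfl]; ring
    | succ j hj ih =>
      have h3 : m.choose (j + 1) ≤ m.choose j := Nat.choose_succ_le_of_le_two_mul (by omega)
      rw [Finset.sum_range_succ]
      omega
  have := h4 (m + 1) (by omega)
  omega

/-- The factor `2 * k + 1` makes the induction close, as `4 (2k + 1) (2k + 3) ≤ 16 (k + 1)²`. -/
theorem two_mul_add_one_mul_centralBinom_sq_le (k : ℕ) :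
    (2 * k + 1) * k.centralBinom ^ 2 ≤ 16 ^ k := by
  induction k with
  | zero => simp
  | succ k ih =>
    have h := Nat.succ_mul_centralBinom_succ k
    have h1 : (k + 1) ^ 2 * ((2 * (k + 1) + 1) * (k + 1).centralBinom ^ 2) =
        4 * (2 * k + 3) * (2 * k + 1) * ((2 * k + 1) * k.centralBinom ^ 2) := by
      calc _ = (2 * (k + 1) + 1) * ((k + 1) * (k + 1).centralBinom) ^ 2 := by ring
        _ = _ := by rw [h]; ring
    refine le_of_mul_le_mul_left ?_ (show 0 < (k + 1) ^ 2 by positivity)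
    rw [h1, pow_succ]
    calc _ ≤ 4 * (2 * k + 3) * (2 * k + 1) * 16 ^ k := Nat.mul_le_mul_left _ ih
      _ ≤ (k + 1) ^ 2 * 16 * 16 ^ k := Nat.mul_le_mul_right _ (by nlinarith)
      _ = _ := by ring

theorem mul_choose_half_sq_le (m : ℕ) : m * m.choose (m / 2) ^ 2 ≤ 4 ^ m := by
  obtain ⟨k, rfl | rfl⟩ := Nat.even_or_odd' m
  · have h := two_mul_add_one_mul_centralBinom_sq_le k
    rw [Nat.centralBinom] at h
    rw [Nat.mul_div_cancel_left _ two_pos, pow_mul]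
    norm_num
    nlinarith [Nat.zero_le ((2 * k).choose k ^ 2)]
  · have h := two_mul_add_one_mul_centralBinom_sq_le k
    rw [Nat.centralBinom] at h
    have hk : (2 * k + 1) / 2 = k := by omega
    have h1 : (2 * k + 1).choose k ≤ 2 * (2 * k).choose k := by
      rw [two_mul ((2 * k).choose k)]
      cases k with
      | zero => simp
      | succ k =>
        rw [Nat.choose_succ_succ']
        have := Nat.choose_le_centralBinom k (k + 1)
        rw [Nat.centralBinom] at this
        omega
    rw [hk, pow_succ 4, pow_mul]
    calc _ ≤ (2 * k + 1) * (2 * (2 * k).choose k) ^ 2 :=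
          Nat.mul_le_mul_left _ (Nat.pow_le_pow_left h1 2)
      _ = ((2 * k + 1) * (2 * k).choose k ^ 2) * 4 := by ring
      _ ≤ _ := by norm_num; exact h

end Choose

/-! ### Matchings between consecutive levels of the Boolean lattice -/

/-- An injection of a finite set `A` into a disjoint set `B` as an involution. -/
theorem exists_involutive_of_injOn {α : Type*} [Nonempty α] [DecidableEq α] {A B : Finset α}
    (hAB : Disjoint A B) (g : α → α) (hg : ∀ x ∈ A, g x ∈ B) (hinj : Set.InjOn g A) :
    ∃ f : α → α, Function.Involutive f ∧
      (∀ x, f x ≠ x → (x ∈ A ∧ f x = g x) ∨ (f x ∈ A ∧ g (f x) = x)) ∧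
      ((A ∪ B).filter fun x => f x = x).card + A.card = B.card := by
  have hB : ∀ x ∈ A, x ∉ B := fun x hx => Finset.disjoint_left.1 hAB hx
  let i := Function.invFunOn g (A : Set α)
  have hi : ∀ x ∈ A, i (g x) = x := fun x hx => hinj.leftInvOn_invFunOn hx
  let f : α → α := fun x => if x ∈ A then g x else if x ∈ A.image g then i x else x
  have f1 : ∀ x ∈ A, f x = g x := fun x hx => by simp [f, hx]
  have f2 : ∀ x ∈ A, f (g x) = x := fun x hx => by
    have h1 : g x ∉ A := fun h => hB _ h (hg x hx)
    have h2 : g x ∈ A.image g := Finset.mem_image_of_mem g hx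
    simp only [f, h1, h2, if_true, if_false]
    exact hi x hx
  have f3 : ∀ x, x ∉ A → x ∉ A.image g → f x = x := fun x h1 h2 => by
    simp only [f, h1, h2, if_false]
  refine ⟨f, fun x => ?_, fun x hx => ?_, ?_⟩
  · by_cases h1 : x ∈ A
    · rw [f1 x h1, f2 x h1]
    · by_cases h2 : x ∈ A.image g
      · obtain ⟨y, hy, rfl⟩ := Finset.mem_image.1 h2
        rw [f2 y hy, f1 y hy]
      · rw [f3 x h1 h2, f3 x h1 h2]
  · by_cases h1 : x ∈ A
    · exact Or.inl ⟨h1, f1 x h1⟩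
    · by_cases h2 : x ∈ A.image g
      · obtain ⟨y, hy, rfl⟩ := Finset.mem_image.1 h2
        rw [f2 y hy]
        exact Or.inr ⟨hy, rfl⟩
      · exact absurd (f3 x h1 h2) hx
  · have hsub : A.image g ⊆ B := by
      intro x hx
      obtain ⟨y, hy, rfl⟩ := Finset.mem_image.1 hx
      exact hg y hy
    have h : ((A ∪ B).filter fun x => f x = x) = B \ A.image g := by
      ext x
      simp only [Finset.mem_filter, Finset.mem_union, Finset.mem_sdiff]
      constructor
      · rintro ⟨h1, h2⟩
        have h3 : x ∉ A := fun h => hB x h (by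
          rw [← h2, f1 x h]
          exact hg x h)
        refine ⟨h1.resolve_left h3, fun h => ?_⟩
        obtain ⟨y, hy, rfl⟩ := Finset.mem_image.1 h
        rw [f2 y hy] at h2
        exact h3 (h2 ▸ hy)
      · rintro ⟨h1, h2⟩
        exact ⟨Or.inr h1, f3 x (fun h => hB x h h1) h2⟩
    rw [h, Finset.card_sdiff_of_subset hsub, Finset.card_image_of_injOn hinj]
    have := Finset.card_le_card hsub
    rw [Finset.card_image_of_injOn hinj] at this
    omega

section Levels

open Finset
open scoped FinsetFamily symmDiff

variable {m : ℕ}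

/-- Above the middle, a level of the Boolean lattice embeds into the level below it along the
covering relation. -/
theorem exists_injOn_level_down {r : ℕ} (h : m ≤ 2 * r + 1) :
    ∃ g : Finset (Fin m) → Finset (Fin m),
      (∀ s, #s = r + 1 → #(g s) = r ∧ #(s ∆ g s) = 1) ∧
        Set.InjOn g {s | #s = r + 1} := by
  -- Hall's theorem; its condition is the local LYM inequality `|S| (r + 1) ≤ |∂S| (m - r)` together
  -- with `m - r ≤ r + 1`.
  obtain ⟨g, hg, hmem⟩ := (Finset.all_card_le_biUnion_card_iff_exists_injective
    fun s : {s : Finset (Fin m) // #s = r + 1} => s.1.image s.1.erase).1 (by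
      intro S
      have hsz : ((S.map (Function.Embedding.subtype _) : Finset (Finset (Fin m))) :
          Set (Finset (Fin m))).Sized (r + 1) := by
        intro s hs
        simp only [coe_map, Set.mem_image] at hs
        obtain ⟨x, -, rfl⟩ := hs
        exact x.2
      have h1 := Finset.local_lubell_yamamoto_meshalkin_inequality_mul hsz
      have h2 : ∂ (S.map (Function.Embedding.subtype _)) =
          S.biUnion fun s => s.1.image s.1.erase := by
        ext t
        simp [mem_shadow_iff]
      rw [h2, card_map, Fintype.card_fin] at h1
      refine Nat.le_of_mul_le_mul_right (h1.trans (Nat.mul_le_mul_left _ ?_)) (Nat.succ_pos r)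
      omega)
  refine ⟨fun s => if hs : #s = r + 1 then g ⟨s, hs⟩ else s, ?_, ?_⟩
  · intro s hs
    simp only [hs, dite_true]
    obtain ⟨a, ha, he⟩ := Finset.mem_image.1 (hmem ⟨s, hs⟩)
    simp only at ha he
    rw [← he]
    refine ⟨by rw [card_erase_of_mem ha, hs]; rfl, ?_⟩
    rw [card_eq_one]
    refine ⟨a, ?_⟩
    ext x
    simp only [mem_symmDiff, mem_erase, mem_singleton]
    constructor
    · tauto
    · rintro rfl
      tauto
  · intro s hs t ht hst
    have hs : #s = r + 1 := hs
    have ht : #t = r + 1 := ht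
    simp only [hs, ht, dite_true] at hst
    exact congrArg Subtype.val (hg hst)

/-- Complementation turns this into the downward case. -/
theorem exists_injOn_level_up {r : ℕ} (h : 2 * r + 1 ≤ m) :
    ∃ g : Finset (Fin m) → Finset (Fin m),
      (∀ s, #s = r → #(g s) = r + 1 ∧ #(s ∆ g s) = 1) ∧ Set.InjOn g {s | #s = r} := by
  obtain ⟨g, hg, hinj⟩ := exists_injOn_level_down (m := m) (r := m - r - 1) (by omega)
  have hc : ∀ s : Finset (Fin m), #s = r → #sᶜ = m - r - 1 + 1 := by
    intro s hs
    rw [card_compl, hs, Fintype.card_fin]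
    omega
  refine ⟨fun s => (g sᶜ)ᶜ, fun s hs => ?_, fun s hs t ht hst => ?_⟩
  · have h1 := hg _ (hc s hs)
    refine ⟨?_, ?_⟩
    · rw [card_compl, h1.1, Fintype.card_fin]
      omega
    · rw [← h1.2, ← compl_symmDiff_compl, compl_compl]
  · exact compl_injective (hinj (hc s hs) (hc t ht) (compl_injective hst))

/-- A maximum matching between two consecutive levels of the Boolean lattice, as an involution. -/
theorem exists_involutive_level (m r : ℕ) :
    ∃ f : Finset (Fin m) → Finset (Fin m), Function.Involutive f ∧
      (∀ s, f s ≠ s → ((#s = r ∧ #(f s) = r + 1) ∨ (#s = r + 1 ∧ #(f s) = r)) ∧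
        #(s ∆ f s) = 1) ∧
      #{s | (#s = r ∨ #s = r + 1) ∧ f s = s} =
        (m.choose r - m.choose (r + 1)) + (m.choose (r + 1) - m.choose r) := by
  have hlevel : ∀ i, #{s : Finset (Fin m) | #s = i} = m.choose i := by
    intro i
    simp
  have hdisj : ∀ i j, i ≠ j → Disjoint (univ.filter fun s : Finset (Fin m) => #s = i)
      (univ.filter fun s => #s = j) := by
    intro i j hij
    rw [disjoint_left]
    intro s hs ht
    simp only [mem_filter, mem_univ, true_and] at hs ht
    exact hij (hs.symm.trans ht)
  rcases le_total m (2 * r + 1) with h | h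
  · obtain ⟨g, hg, hinj⟩ := exists_injOn_level_down h
    obtain ⟨f, hf, hmove, hcard⟩ := exists_involutive_of_injOn (hdisj (r + 1) r (by omega)) g
      (by simpa using fun s hs => (hg s hs).1) (hinj.mono fun s hs => by simpa using hs)
    refine ⟨f, hf, fun s hs => ?_, ?_⟩
    · simp only [mem_filter, mem_univ, true_and] at hmove
      rcases hmove s hs with ⟨h1, h2⟩ | ⟨h1, h2⟩
      · rw [h2]
        exact ⟨Or.inr ⟨h1, (hg s h1).1⟩, (hg s h1).2⟩
      · have h3 := hg _ h1
        rw [h2] at h3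
        exact ⟨Or.inl ⟨h3.1, h1⟩, by rw [symmDiff_comm]; exact h3.2⟩
    · have h1 : (univ.filter fun s : Finset (Fin m) => (#s = r ∨ #s = r + 1) ∧ f s = s) =
          ((univ.filter fun s : Finset (Fin m) => #s = r + 1) ∪
            (univ.filter fun s => #s = r)).filter fun s => f s = s := by
        ext s
        simp only [mem_filter, mem_univ, true_and, mem_union, or_comm]
      rw [h1]
      rw [hlevel, hlevel] at hcard
      omega
  · obtain ⟨g, hg, hinj⟩ := exists_injOn_level_up h
    obtain ⟨f, hf, hmove, hcard⟩ := exists_involutive_of_injOn (hdisj r (r + 1) (by omega)) g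
      (by simpa using fun s hs => (hg s hs).1) (hinj.mono fun s hs => by simpa using hs)
    refine ⟨f, hf, fun s hs => ?_, ?_⟩
    · simp only [mem_filter, mem_univ, true_and] at hmove
      rcases hmove s hs with ⟨h1, h2⟩ | ⟨h1, h2⟩
      · rw [h2]
        exact ⟨Or.inl ⟨h1, (hg s h1).1⟩, (hg s h1).2⟩
      · have h3 := hg _ h1
        rw [h2] at h3
        exact ⟨Or.inr ⟨h3.1, h1⟩, by rw [symmDiff_comm]; exact h3.2⟩
    · have h1 : (univ.filter fun s : Finset (Fin m) => (#s = r ∨ #s = r + 1) ∧ f s = s) =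
          ((univ.filter fun s : Finset (Fin m) => #s = r) ∪
            (univ.filter fun s => #s = r + 1)).filter fun s => f s = s := by
        ext s
        simp only [mem_filter, mem_univ, true_and, mem_union]
      rw [h1]
      rw [hlevel, hlevel] at hcard
      omega

end Levels

/-! ### The upper bound for hypercubes -/

section Cube

open Finset
open scoped symmDiff

/-- The involution that matches the levels `r` and `r + 1` of the Boolean lattice for all `r`
congruent to `c + 1` modulo `3`. -/
theorem exists_involutive_levels_mod_three (m : ℕ) {c : ℕ} (hc : c < 3) :
    ∃ f : Finset (Fin m) → Finset (Fin m), Function.Involutive f ∧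
      (∀ s, f s ≠ s → #s % 3 ≠ c ∧ #(s ∆ f s) = 1) ∧
      #{s | #s % 3 ≠ c ∧ f s = s} ≤ (if c = 1 then 1 else 0) +
        ∑ r ∈ range (m + 1) with (r + 2) % 3 = c,
          ((m.choose r - m.choose (r + 1)) + (m.choose (r + 1) - m.choose r)) := by
  choose F hF hmove hcard using exists_involutive_level m
  -- Sizes congruent to `c + 1` form the lower level of a pair, sizes congruent to `c + 2` the upper
  -- one. For `c = 1` the empty set would be an upper level with nothing below; it stays fixed and
  -- accounts for the extra 1.
  let f : Finset (Fin m) → Finset (Fin m) := fun s =>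
    if #s % 3 = c then s else if (#s + 2) % 3 = c then F #s s else
      if #s = 0 then s else F (#s - 1) s
  have f0 : ∀ s, #s % 3 = c → f s = s := fun s h => by simp [f, h]
  have f1 : ∀ s r, #s = r ∨ #s = r + 1 → (r + 2) % 3 = c → f s = F r s := by
    rintro s r (h | h) h'
    · have h1 : ¬ r % 3 = c := by omega
      simp [f, h, h', h1]
    · have h1 : ¬ (r + 1) % 3 = c := by omega
      have h2 : ¬ (r + 1 + 2) % 3 = c := by omega
      simp only [f, h, h1, h2, if_false]
      simp
  have f2 : ∀ s, #s = 0 → c = 1 → f s = s := fun s h h' => by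
    simp only [f, h, h']
    simp
  have hcases : ∀ s : Finset (Fin m), #s % 3 = c ∨ (#s = 0 ∧ c = 1) ∨
      ∃ r, (r + 2) % 3 = c ∧ (#s = r ∨ #s = r + 1) := by
    intro s
    by_cases h1 : #s % 3 = c
    · exact Or.inl h1
    · by_cases h2 : (#s + 2) % 3 = c
      · exact Or.inr (Or.inr ⟨_, h2, Or.inl rfl⟩)
      · by_cases h3 : #s = 0
        · exact Or.inr (Or.inl ⟨h3, by omega⟩)
        · exact Or.inr (Or.inr ⟨#s - 1, by omega, Or.inr (by omega)⟩)
  refine ⟨f, fun s => ?_, fun s hs => ?_, ?_⟩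
  · rcases hcases s with h | ⟨h, h'⟩ | ⟨r, h, h'⟩
    · rw [f0 s h, f0 s h]
    · rw [f2 s h h', f2 s h h']
    · rw [f1 s r h' h]
      have h2 : #(F r s) = r ∨ #(F r s) = r + 1 := by
        by_cases h3 : F r s = s
        · rwa [h3]
        · have := (hmove r s h3).1
          omega
      rw [f1 _ r h2 h, hF r s]
  · rcases hcases s with h | ⟨h, h'⟩ | ⟨r, h, h'⟩
    · exact absurd (f0 s h) hs
    · exact absurd (f2 s h h') hs
    · rw [f1 s r h' h] at hs ⊢
      exact ⟨by omega, (hmove r s hs).2⟩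
  · have hsub : (univ.filter fun s : Finset (Fin m) => #s % 3 ≠ c ∧ f s = s) ⊆
        (if c = 1 then {∅} else ∅) ∪ (range (m + 1) |>.filter fun r => (r + 2) % 3 = c).biUnion
          fun r => univ.filter fun s => (#s = r ∨ #s = r + 1) ∧ F r s = s := by
      intro s hs
      simp only [mem_filter, mem_univ, true_and] at hs
      rw [mem_union, mem_biUnion]
      rcases hcases s with h | ⟨h, h'⟩ | ⟨r, h, h'⟩
      · exact absurd h hs.1
      · left
        simp [h', card_eq_zero.1 h]
      · right
        have hm : #s ≤ m := by simpa using card_le_univ s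
        refine ⟨r, by simp [h]; omega, ?_⟩
        simp only [mem_filter, mem_univ, true_and]
        exact ⟨h', by rw [← f1 s r h' h]; exact hs.2⟩
    refine (card_le_card hsub).trans ((card_union_le _ _).trans (add_le_add ?_ ?_))
    · split_ifs <;> simp
    · exact card_biUnion_le.trans (sum_le_sum fun r _ => (hcard r).le)

theorem SimpleGraph.three_mul_minMaximalMatching_le_of_equiv_finset {V : Type*} [Fintype V]
    [DecidableEq V] {G : SimpleGraph V} {m : ℕ} (e : V ≃ Finset (Fin m))
    (he : ∀ x y, G.Adj x y ↔ #(e x ∆ e y) = 1) :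
    3 * G.minMaximalMatching ≤ 2 ^ m + m.choose (m / 2) := by
  have hV : Fintype.card V = 2 ^ m := by
    rw [Fintype.card_congr e]
    simp
  have hone : ∀ c ∈ range 3, 2 * G.minMaximalMatching + #{x : V | #(e x) % 3 = c} ≤
      2 ^ m + ((if c = 1 then 1 else 0) + ∑ r ∈ range (m + 1) with (r + 2) % 3 = c,
          ((m.choose r - m.choose (r + 1)) + (m.choose (r + 1) - m.choose r))) := by
    intro c hc
    obtain ⟨f, hf, hmove, hcard⟩ := exists_involutive_levels_mod_three m (mem_range.1 hc)
    have hfix : ∀ x, e.symm (f (e x)) = x ↔ f (e x) = e x := fun x => e.symm_apply_eq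
    have h := G.two_mul_minMaximalMatching_le (fun x => e.symm (f (e x)))
      (fun x => by simp [hf (e x)])
      (fun x hx => by
        rw [he, e.apply_symm_apply]
        exact (hmove _ (mt (hfix x).2 hx)).2)
      (univ.filter fun x => #(e x) % 3 ≠ c ∧ f (e x) = e x) (by
        intro x y hx hy hxy
        rw [hfix] at hx hy
        simp only [mem_filter, mem_univ, true_and, hx, hy, and_true]
        -- Otherwise both sets have size congruent to `c` mod 3, while adjacent sets differ in size
        -- by one.
        by_contra! h
        have h1 := card_sdiff_add_card_inter (e x) (e y)
        have h2 := card_sdiff_add_card_inter (e y) (e x)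
        rw [he, symmDiff_def, sup_eq_union,
          Finset.card_union_of_disjoint disjoint_sdiff_sdiff] at hxy
        rw [inter_comm] at h2
        omega)
    have hW : #{x | #(e x) % 3 ≠ c ∧ f (e x) = e x} = #{s | #s % 3 ≠ c ∧ f s = s} :=
      card_equiv e (by simp)
    rw [← hW] at hcard
    simp only [ne_eq, hfix] at h
    have hpart : #{x | ¬ f (e x) = e x} + #{x | #(e x) % 3 ≠ c ∧ f (e x) = e x} +
        #{x : V | #(e x) % 3 = c} = 2 ^ m := by
      rw [← hV, ← card_univ, ← card_union_of_disjoint, ← card_union_of_disjoint]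
      · congr 1
        ext x
        simp only [mem_union, mem_filter, mem_univ, true_and, iff_true]
        tauto
      · rw [Finset.disjoint_left]
        intro x hx hx'
        simp only [mem_union, mem_filter, mem_univ, true_and] at hx hx'
        rcases hx with hx | hx
        · exact (hmove _ hx).1 hx'
        · exact hx.1 hx'
      · rw [Finset.disjoint_left]
        intro x hx hx'
        simp only [mem_filter, mem_univ, true_and] at hx hx'
        exact hx hx'.2
    simp only [ne_eq] at hcard hpart
    omega
  have hdist := sum_dist_choose_le m
  -- Adding the three cases uses each vertex and each defect once: `6 M + 2 ^ m ≤ 3 * 2 ^ m + 1 + ∑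
  -- D r`.
  have hsum := sum_le_sum hone
  generalize (fun r => (m.choose r - m.choose (r + 1)) + (m.choose (r + 1) - m.choose r)) = D
    at hdist hsum
  have hdist : 1 + ∑ r ∈ range (m + 1), D r ≤ 2 * m.choose (m / 2) := hdist
  have hfib : ∑ c ∈ range 3, #{x : V | #(e x) % 3 = c} = 2 ^ m := by
    rw [← hV, ← card_univ]
    exact (card_eq_sum_card_fiberwise fun x _ => by simp [Nat.mod_lt]).symm
  simp only [sum_add_distrib] at hsum
  rw [hfib, sum_fiberwise_of_maps_to fun r _ => mem_range.2 (Nat.mod_lt _ three_pos)] at hsum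
  simp only [sum_const, card_range, sum_ite_eq', mem_range, smul_eq_mul] at hsum
  norm_num at hsum
  omega

theorem SimpleGraph.three_mul_minMaximalMatching_le_of_iso_hypercube {V : Type*} [Fintype V]
    [DecidableEq V] {G : SimpleGraph V} {m : ℕ} (φ : G ≃g hypercube m) :
    3 * G.minMaximalMatching ≤ 2 ^ m + m.choose (m / 2) := by
  let e : (Fin m → Bool) ≃ Finset (Fin m) :=
    { toFun := fun x => univ.filter fun i => x i = true
      invFun := fun s i => decide (i ∈ s)
      left_inv := fun x => by simp
      right_inv := fun s => by simp }
  refine G.three_mul_minMaximalMatching_le_of_equiv_finset (φ.toEquiv.trans e) fun x y => ?_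
  rw [← φ.map_adj_iff]
  change hammingDist (φ x) (φ y) = 1 ↔ #(e (φ x) ∆ e (φ y)) = 1
  have h : e (φ x) ∆ e (φ y) = univ.filter fun i => φ x i ≠ φ y i := by
    ext i
    cases h1 : φ x i <;> cases h2 : φ y i <;> simp [e, mem_symmDiff, h1, h2]
  rw [h, hammingDist]

end Cube

/-! ### Recognising hypercubes, and the final bounds -/

theorem minMaximalMatching_permutahedronProd_le_of_isHypercube {k : ℕ} {n : Fin k → ℕ}
    (hn : ∀ i, 2 ≤ n i) (h : (permutahedronProd n).IsHypercube) :
    ((permutahedronProd n).minMaximalMatching : ℝ) ≤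
      (1 / 3 + 1 / Real.sqrt ((∑ i, n i : ℕ) : ℝ)) *
        (Fintype.card (∀ i, Equiv.Perm (Fin (n i))) : ℝ) := by
  obtain ⟨m, ⟨φ⟩⟩ := h
  have hcard : Fintype.card (∀ i, Equiv.Perm (Fin (n i))) = 2 ^ m := by
    rw [Fintype.card_congr φ.toEquiv]
    simp
  have hprod : ∏ i, (n i).factorial = 2 ^ m := by
    rw [← hcard]
    simp [Fintype.card_pi, Fintype.card_perm]
  -- A factor with `n i ≥ 3` would make the number of vertices, a power of 2, divisible by 3.
  have hn2 : ∀ i, n i = 2 := by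
    intro i
    refine le_antisymm ?_ (hn i)
    by_contra! hi
    have h1 : 3 ∣ 2 ^ m := by
      rw [← hprod]
      exact (Nat.dvd_factorial three_pos hi).trans (Finset.dvd_prod_of_mem _ (Finset.mem_univ i))
    have := Nat.Prime.dvd_of_dvd_pow Nat.prime_three h1
    omega
  have hm : m = k := by
    simp only [hn2] at hprod
    simp at hprod
    exact hprod.symm
  subst hm
  have hM := SimpleGraph.three_mul_minMaximalMatching_le_of_iso_hypercube φ
  rw [hcard]
  simp only [hn2]
  simp only [Finset.sum_const, Finset.card_univ, Fintype.card_fin, smul_eq_mul]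
  have hM' : 3 * ((permutahedronProd n).minMaximalMatching : ℝ) ≤ 2 ^ m + m.choose (m / 2) := by
    exact_mod_cast hM
  push_cast
  -- For the empty product the term `1 / √0` is 0 by convention, but then the matching is empty.
  rcases Nat.eq_zero_or_pos m with rfl | hpos
  · have : (permutahedronProd n).minMaximalMatching = 0 := by
      simp at hM
      omega
    rw [this]
    simp
  · have hs : 0 < Real.sqrt ((m : ℝ) * 2) := Real.sqrt_pos.2 (by positivity)
    have hsq : Real.sqrt ((m : ℝ) * 2) ^ 2 = m * 2 := Real.sq_sqrt (by positivity)
    have hc : (m : ℝ) * (m.choose (m / 2) : ℝ) ^ 2 ≤ 4 ^ m := by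
      exact_mod_cast mul_choose_half_sq_le m
    have h4 : (4 : ℝ) ^ m = (2 ^ m) ^ 2 := by
      rw [← pow_mul, mul_comm, pow_mul]
      norm_num
    -- The true constant is `√2`; 3 is ample and, after division by 3, gives `C = 1` with `N = 2m`.
    have h5 : Real.sqrt ((m : ℝ) * 2) * m.choose (m / 2) ≤ 3 * 2 ^ m := by
      refine abs_le_of_sq_le_sq' ?_ (by positivity) |>.2
      rw [mul_pow, hsq, mul_pow, ← h4]
      nlinarith [pow_pos (show (0 : ℝ) < 4 by norm_num) m]
    have h6 : (m.choose (m / 2) : ℝ) ≤ 3 * 2 ^ m / Real.sqrt ((m : ℝ) * 2) := by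
      rw [le_div_iff₀ hs]
      linarith
    calc ((permutahedronProd n).minMaximalMatching : ℝ)
        ≤ (2 ^ m + 3 * 2 ^ m / Real.sqrt ((m : ℝ) * 2)) / 3 := by linarith
      _ = _ := by ring

/-- If every `n i` is 2, each factor is a single edge and the product is the cube `Q_k`. -/
theorem exists_three_le_of_not_isHypercube {k : ℕ} {n : Fin k → ℕ} (hn : ∀ i, 2 ≤ n i)
    (h : ¬ (permutahedronProd n).IsHypercube) : ∃ i, 3 ≤ n i := by
  by_contra! h3
  have hn2 : n = fun _ => 2 := funext fun i => by have := hn i; have := h3 i; omega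
  subst hn2
  refine h ⟨k, ⟨?_⟩⟩
  let e : Equiv.Perm (Fin 2) ≃ Bool :=
    { toFun := fun σ => decide (σ = 1)
      invFun := fun b => if b then 1 else Equiv.swap 0 1
      left_inv := by decide
      right_inv := by decide }
  have hadj : ∀ σ ρ, (permutahedron 2).Adj σ ρ ↔ σ ≠ ρ := by
    intro σ ρ
    rw [permutahedron_adj]
    revert σ ρ
    decide
  refine ⟨Equiv.piCongrRight fun _ => e, ?_⟩
  intro x y
  change hammingDist (fun i => e (x i)) (fun i => e (y i)) = 1 ↔ (permutahedronProd _).Adj x y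
  rw [hammingDist, Finset.card_eq_one]
  constructor
  · rintro ⟨i, hi⟩
    have h1 : ∀ j, x j ≠ y j ↔ j = i := by
      intro j
      have := Finset.ext_iff.1 hi j
      simpa using this
    refine ⟨i, (hadj _ _).2 ((h1 i).2 rfl), fun j hj => ?_⟩
    by_contra hne
    exact hj ((h1 j).1 hne)
  · rintro ⟨i, h1, h2⟩
    refine ⟨i, ?_⟩
    ext j
    simp only [Finset.mem_filter, Finset.mem_univ, true_and, Finset.mem_singleton, ne_eq,
      e.injective.eq_iff]
    constructor
    · exact fun h3 => by_contra fun h4 => h3 (h2 j h4)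
    · rintro rfl
      exact (hadj _ _).1 h1

theorem theorem2 :
    ∃ C : ℝ, ∀ (k : ℕ) (n : Fin k → ℕ) (N : ℕ), (∀ i, 2 ≤ n i) → N = ∑ i, n i →
      ((N : ℝ) - (k : ℝ)) / (3 * (N : ℝ) - 3 * (k : ℝ) + 1) *
          (Nat.card (∀ i, Equiv.Perm (Fin (n i))) : ℝ)
        ≤ ((permutahedronProd n).minMaximalMatching : ℝ) ∧
      ((permutahedronProd n).IsHypercube →
        ((permutahedronProd n).minMaximalMatching : ℝ)
          ≤ (1 / 3 + C / Real.sqrt (N : ℝ)) *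
              (Nat.card (∀ i, Equiv.Perm (Fin (n i))) : ℝ)) ∧
      (¬ (permutahedronProd n).IsHypercube →
        ((permutahedronProd n).minMaximalMatching : ℝ)
          ≤ 1 / 3 * (Nat.card (∀ i, Equiv.Perm (Fin (n i))) : ℝ)) := by
  refine ⟨1, fun k n N hn hN => ?_⟩
  subst hN
  rw [Nat.card_eq_fintype_card]
  refine ⟨?_, fun h => minMaximalMatching_permutahedronProd_le_of_isHypercube hn h, fun h => ?_⟩
  · have hd : ((∑ i, (n i - 1) : ℕ) : ℝ) = ((∑ i, n i : ℕ) : ℝ) - k := by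
      rw [Nat.cast_sum, Finset.sum_congr rfl fun i _ =>
        Nat.cast_sub (R := ℝ) (one_le_two.trans (hn i))]
      simp
    have h : ((∑ i, (n i - 1) : ℕ) : ℝ) * Fintype.card (∀ i, Equiv.Perm (Fin (n i))) ≤
        (3 * ((∑ i, (n i - 1) : ℕ) : ℝ) + 1) * (permutahedronProd n).minMaximalMatching := by
      exact_mod_cast mul_card_le_minMaximalMatching_permutahedronProd (n := n)
    have hpos : (0 : ℝ) ≤ ((∑ i, (n i - 1) : ℕ) : ℝ) := Nat.cast_nonneg _
    rw [hd] at h hpos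
    rw [div_mul_eq_mul_div, div_le_iff₀ (by linarith)]
    linarith
  · obtain ⟨i, hi⟩ := exists_three_le_of_not_isHypercube hn h
    have h3 : 3 * ((permutahedronProd n).minMaximalMatching : ℝ) ≤
        Fintype.card (∀ i, Equiv.Perm (Fin (n i))) := by
      exact_mod_cast three_mul_minMaximalMatching_permutahedronProd_le i hi
    linarith
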